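/- Let $\mathcal P_n=(P,L)$ be a finite projective plane of order $n$. A $c$-coloring is a map $C:P\to[c]=\{1,\dots,c\}$; the type of a line $\ell$ is the vector $t_{\ell,C}=(|\ell\cap C^{-1}(1)|,\dots,|\ell\cap C^{-1}(c)|)$, and $C$ is legitimate if distinct lines have distinct types. Let $S\subseteq P$ be a set of points with $\ln n\le|\ell\cap S|\le 11\ln n$ for every line $\ell\in L$. For a partial coloring $f:P\setminus S\to[d]$ let $t_{\ell,f}=(|\ell\cap f^{-1}(1)|,\dots,|\ell\cap f^{-1}(d)|)$, and call a pair $\{\ell,\ell'\}$ of distinct lines dangerous for $f$ if $\sum_{i=1}^d|(t_{\ell,f})_i-(t_{\ell',f})_i|\le 22\ln n$; a point $p$ belongs to the pair if $p\in\ell\cup\ell'$. Let $a,b\ge 0$ be integers and let $d$ be any number of colors for which there is a partial coloring $f:P\setminus S\to[d]$ such that every point belongs to at most $a\cdot b$ dangerous pairs (for instance the least such number, $\mathsf d(n,a,b)$, if one exists). Then $\mathcal P_n$ has a legitimate coloring with $$\max\Big(d,\ \Big\lceil\min_{m\ge 2}\frac{m}{m-1}\big(m!\,a\,b\,(m-1)\big)^{1/m}\Big\rceil\Big)$$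 colors. -/

import Mathlib

noncomputable section

namespace LegitimateColoring

open Configuration

variable {P L : Type*} [Membership P L]

/-- The type of the line `l` under a coloring `f` of all points with colors in `Fin c`:
its `i`-th coordinate is the number of points of `l` with color `i`. -/
def lineType {c : ℕ} (f : P → Fin c) (l : L) : Fin c → ℕ :=
  fun i => {p : P | p ∈ l ∧ f p = i}.ncard

/-- A coloring is legitimate if no two distinct lines have the same type. -/
def IsLegitimate (L : Type*) [Membership P L] {c : ℕ} (f : P → Fin c) : Prop :=
  ∀ l l' : L, l ≠ l' → lineType f l ≠ lineType f l'

/-- The sets left uncolored: `ln n ≤ |l ∩ S| ≤ 11 ln n` for every line `l`, where `n` is the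
order of the plane. -/
def IsReserved (L : Type*) [Membership P L] [ProjectivePlane P L] (S : Set P) : Prop :=
  ∀ l : L, Real.log (ProjectivePlane.order P L) ≤ ({p : P | p ∈ l ∧ p ∈ S}.ncard : ℝ) ∧
    ({p : P | p ∈ l ∧ p ∈ S}.ncard : ℝ) ≤ 11 * Real.log (ProjectivePlane.order P L)

/-- The type of the line `l` under a partial coloring `f : P ∖ S → Fin d`; points of `S` are
not counted. -/
def partialLineType {S : Set P} {d : ℕ} (f : {p : P // p ∉ S} → Fin d) (l : L) : Fin d → ℕ :=
  fun i => {x : {p : P // p ∉ S} | x.1 ∈ l ∧ f x = i}.ncard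

/-- Two distinct lines form a dangerous pair for a partial coloring `f` if their types under `f`
are at `ℓ¹`-distance at most `22 ln n`. -/
def IsDangerous [ProjectivePlane P L] {S : Set P} {d : ℕ} (f : {p : P // p ∉ S} → Fin d)
    (l l' : L) : Prop :=
  l ≠ l' ∧ (∑ i, |(partialLineType f l i : ℝ) - (partialLineType f l' i : ℝ)|) ≤
    22 * Real.log (ProjectivePlane.order P L)

/-- The (unordered) dangerous pairs of lines to which the point `p` belongs. -/
def dangerousPairsAt (L : Type*) [Membership P L] [ProjectivePlane P L] {S : Set P} {d : ℕ}
    (f : {p : P // p ∉ S} → Fin d) (p : P) : Set (Sym2 L) :=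
  {z | ∃ l l' : L, z = s(l, l') ∧ IsDangerous f l l' ∧ (p ∈ l ∨ p ∈ l')}

/-- `min_{m ≥ 2} (m / (m - 1)) (m! k (m - 1)) ^ (1 / m)`. -/
def entropyBound (k : ℕ) : ℝ :=
  ⨅ m : {m : ℕ // 2 ≤ m},
    ((m : ℕ) : ℝ) / (((m : ℕ) : ℝ) - 1) *
      (((m : ℕ).factorial : ℝ) * (k : ℝ) * (((m : ℕ) : ℝ) - 1)) ^ (1 / ((m : ℕ) : ℝ))

end LegitimateColoring

end

namespace LegitimateColoring

open Finset Configuration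

/-! Color `S` on top of `f`. Since a line has at most `11 ln n` points in `S`, only dangerous pairs
can end up with equal types, so only these must be separated. This is done by Rosenfeld's counting
method (`exists_coloring_avoiding`): coloring the points of `S` one at a time, the number of
colorings in which no fully colored dangerous pair coincides grows by a factor at least `β` at each
step. If `m` reserved points of `ℓ ∖ ℓ'` are recolored and everything else is fixed, a coincidence
prescribes the color counts on them, leaving at most `m!` choices. The induction therefore closes
when `β + k m! / β ^ (m - 1) ≤ q`, where `k = a b`, and optimizing `β` gives exactly the `m`-th term
of the entropy bound.

This needs `m < ln n`, since `m` reserved points must survive outside the other line, whereas the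
minimizing `m` depends only on `k`. Small orders are treated differently. Twelve colors always
suffice by a first moment count (`exists_isLegitimate_of_lt`), and ten suffice for `n ≤ 6` and `n ≥
400`. With fewer colors, a second moment computation (`order_bound`) shows that line types are too
concentrated for few pairs to be dangerous unless `n` is large. The remaining small orders either
contradict this or yield to the first moment, and for `n ≥ 1097` one has `ln n > 7`, which covers
every `m` needed for `q ≤ 9`. -/

/-! ### Multinomial estimates -/

/-- The number of colorings of the points of `T` with prescribed color counts is at most the
multinomial coefficient. -/
theorem card_prescribed_mul_prod_factorial_le {V : Type*} [Fintype V]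
    [DecidableEq V] {c : ℕ} (T : Finset V) (C₀ : V → Fin c) (κ : Fin c → ℕ) :
    #{C : V → Fin c | (∀ p ∉ T, C p = C₀ p) ∧ ∀ i, #{p ∈ T | C p = i} = κ i} *
      ∏ i, (κ i).factorial ≤ (#T).factorial := by
  induction T using Finset.induction_on generalizing C₀ κ with
  | empty =>
    by_cases h : ∀ i, κ i = 0
    · have : #{C : V → Fin c | (∀ p ∉ (∅ : Finset V), C p = C₀ p) ∧
          ∀ i, #{p ∈ (∅ : Finset V) | C p = i} = κ i} ≤ 1 := by
        rw [Finset.card_le_one]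
        intro A hA B hB
        simp only [mem_filter, notMem_empty, not_false_eq_true, forall_const, mem_univ,
          true_and] at hA hB
        funext p
        rw [hA.1 p, hB.1 p]
      simpa [h] using this
    · push Not at h
      obtain ⟨i, hi⟩ := h
      rw [Finset.filter_eq_empty_iff.2]
      · simp
      · rintro C - ⟨-, h⟩
        exact hi (by simpa using (h i).symm)
  | insert v T hv ih =>
    set F : Finset (V → Fin c) :=
      {C | (∀ p ∉ insert v T, C p = C₀ p) ∧ ∀ i, #{p ∈ insert v T | C p = i} = κ i} with hF
    rcases F.eq_empty_or_nonempty with h0 | ⟨D, hD⟩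
    · simp [h0]
    have hsum : ∑ i, κ i = #T + 1 := by
      rw [hF, mem_filter] at hD
      rw [← card_insert_of_notMem hv,
        Finset.card_eq_sum_card_fiberwise (f := D) (t := univ) (fun _ _ => mem_coe.2 (mem_univ _))]
      exact Finset.sum_congr rfl fun i _ => (hD.2.2 i).symm
    let G : Fin c → Finset (V → Fin c) := fun j =>
      {C | (∀ p ∉ T, C p = Function.update C₀ v j p) ∧
        ∀ i, #{p ∈ T | C p = i} = Function.update κ j (κ j - 1) i}
    -- Splitting by the color `j` of `v` mirrors the Pascal recursion for multinomial coefficients.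
    have hsub : F ⊆ ({j | κ j ≠ 0} : Finset (Fin c)).biUnion G := by
      intro C hC
      rw [hF, mem_filter] at hC
      obtain ⟨-, h1, h2⟩ := hC
      have hcount : ∀ i, (if C v = i then 1 else 0) + #{p ∈ T | C p = i} = κ i := by
        intro i
        rw [← h2 i, Finset.filter_insert]
        split_ifs with hi
        · rw [card_insert_of_notMem (by simp [hv])]; omega
        · simp
      rw [mem_biUnion]
      refine ⟨C v, ?_, ?_⟩
      · have := hcount (C v)
        simp only [if_true] at this
        simp only [mem_filter, mem_univ, true_and]
        omega
      · simp only [G, mem_filter, mem_univ, true_and]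
        constructor
        · intro p hp
          by_cases hpv : p = v
          · subst hpv; simp
          · rw [Function.update_of_ne hpv]
            exact h1 p (by simp [hpv, hp])
        · intro i
          have := hcount i
          by_cases hi : i = C v
          · subst hi
            simp only [if_true] at this
            simp only [Function.update_self]
            omega
          · rw [Function.update_of_ne hi]
            rw [if_neg (fun h => hi h.symm)] at this
            omega
    calc #F * ∏ i, (κ i).factorial
        ≤ (∑ j ∈ ({j | κ j ≠ 0} : Finset (Fin c)), #(G j)) * ∏ i, (κ i).factorial :=
          Nat.mul_le_mul_right _ ((card_le_card hsub).trans card_biUnion_le)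
      _ ≤ ∑ j ∈ ({j | κ j ≠ 0} : Finset (Fin c)), κ j * (#T).factorial := by
          rw [Finset.sum_mul]
          refine Finset.sum_le_sum fun j hj => ?_
          have hj' : κ j ≠ 0 := by simpa using hj
          have hprod : ∏ i, (κ i).factorial =
              κ j * ∏ i, (Function.update κ j (κ j - 1) i).factorial := by
            rw [← Finset.mul_prod_erase univ _ (mem_univ j),
              ← Finset.mul_prod_erase univ
                (fun i => (Function.update κ j (κ j - 1) i).factorial) (mem_univ j),
              Function.update_self, ← mul_assoc, Nat.mul_factorial_pred hj']
            congr 1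
            refine Finset.prod_congr rfl fun i hi => ?_
            rw [Function.update_of_ne (ne_of_mem_erase hi)]
          rw [hprod, mul_left_comm]
          exact Nat.mul_le_mul_left _ (ih _ _)
      _ ≤ ∑ j, κ j * (#T).factorial :=
          Finset.sum_le_sum_of_subset (filter_subset _ _)
      _ = (#(insert v T)).factorial := by
          rw [← Finset.sum_mul, hsum, card_insert_of_notMem hv, Nat.factorial_succ]

/-- The ratio of consecutive values of `k! / (q + 1) ^ k` is `(k + 1) / (q + 1)`, so the minimum is
at `k = q`, and again at `k = q + 1`. -/
theorem factorial_mul_succ_pow_le (q k : ℕ) :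
    q.factorial * (q + 1) ^ k ≤ k.factorial * (q + 1) ^ q := by
  rcases le_total q k with h | h
  · obtain ⟨r, rfl⟩ := Nat.exists_eq_add_of_le h
    calc q.factorial * (q + 1) ^ (q + r) = q.factorial * (q + 1) ^ r * (q + 1) ^ q := by
          rw [pow_add]; ring
      _ ≤ _ := Nat.mul_le_mul_right _ Nat.factorial_mul_pow_le_factorial
  · obtain ⟨r, rfl⟩ := Nat.exists_eq_add_of_le h
    have h1 : (k + r).factorial ≤ k.factorial * (k + r + 1) ^ r := by
      rw [← Nat.factorial_mul_ascFactorial]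
      refine Nat.mul_le_mul_left _ ((Nat.ascFactorial_le_pow_add k r).trans ?_)
      exact Nat.pow_le_pow_left (by omega) r
    calc (k + r).factorial * (k + r + 1) ^ k
        ≤ k.factorial * (k + r + 1) ^ r * (k + r + 1) ^ k := Nat.mul_le_mul_right _ h1
      _ = _ := by rw [pow_add]; ring

/-- A division-free upper bound for multinomial coefficients, sharp when every `κ i` is `q` or `q +
1`. -/
theorem factorial_pow_mul_le_prod_factorial {c m : ℕ} (q : ℕ)
    (κ : Fin c → ℕ) (h : ∑ i, κ i = m) :
    q.factorial ^ c * (q + 1) ^ m ≤ (∏ i, (κ i).factorial) * (q + 1) ^ (q * c) := by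
  calc q.factorial ^ c * (q + 1) ^ m = ∏ i, q.factorial * (q + 1) ^ κ i := by
        rw [prod_mul_distrib, prod_pow_eq_pow_sum, h]; simp
    _ ≤ ∏ i, (κ i).factorial * (q + 1) ^ q :=
        prod_le_prod' fun i _ => factorial_mul_succ_pow_le q (κ i)
    _ = _ := by rw [prod_mul_distrib]; simp [pow_mul]

/-! ### Rosenfeld's counting argument -/

/-- A coloring avoiding all bad events exists if each point lies in the support of at most `k`
events and each event can be decided on `m` points with at most `b` choices. -/
theorem exists_coloring_avoiding {V ι : Type*} [Fintype V] [DecidableEq V]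
    [Fintype ι] {q m k b : ℕ} {β : ℝ} (hβ : 0 < β) (supp : ι → Finset V)
    (bad : ι → (V → Fin q) → Prop) (hne : ∀ e, (supp e).Nonempty)
    (hloc : ∀ e C C', (∀ v ∈ supp e, C v = C' v) → bad e C → bad e C')
    (hk : ∀ v, {e | v ∈ supp e}.ncard ≤ k)
    (hT : ∀ e, ∀ v ∈ supp e, ∃ T ⊆ supp e, v ∈ T ∧ #T = m ∧
      ∀ C₀ : V → Fin q, {C | (∀ p ∉ T, C p = C₀ p) ∧ bad e C}.ncard ≤ b)
    (hq : β + k * b / β ^ (m - 1) ≤ q) : ∃ C, ∀ e, ¬ bad e C := by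
  classical
  have hq0 : 0 < q := by
    have : 0 ≤ k * b / β ^ (m - 1) := by positivity
    have : (0 : ℝ) < q := by linarith
    exact_mod_cast this
  let c₀ : Fin q := ⟨0, hq0⟩
  -- Colorings of `X` are encoded as total colorings with the default `c₀` off `X`, so that all
  -- stages live in one type.
  let good : Finset V → Finset (V → Fin q) := fun X =>
    {C | (∀ v ∉ X, C v = c₀) ∧ ∀ e, supp e ⊆ X → ¬ bad e C}
  have mem_good : ∀ X C, C ∈ good X ↔
      (∀ v ∉ X, C v = c₀) ∧ ∀ e, supp e ⊆ X → ¬ bad e C := by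
    intro X C; simp [good]
  have key : ∀ N : ℕ, ∀ X : Finset V, #X = N → ∀ v ∉ X,
      β * #(good X) ≤ #(good (insert v X)) := by
    intro N
    induction N using Nat.strong_induction_on with
    | _ N ih =>
    intro X hX v hv
    -- Restoring the points of `T` one by one gains a factor `β` each time, by strong induction on
    -- the size of the colored set.
    have chain : ∀ T : Finset V, T ⊆ X → β ^ #T * #(good (X \ T)) ≤ #(good X) := by
      intro T
      induction T using Finset.induction_on with
      | empty => intro _; simp
      | insert w T hw ihT =>
        intro hsub
        have hwX : w ∈ X := hsub (mem_insert_self _ _)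
        have h1 := ihT ((subset_insert _ _).trans hsub)
        have h2 : insert w (X \ insert w T) = X \ T := by
          ext x
          simp only [mem_insert, mem_sdiff]
          by_cases hxw : x = w
          · subst hxw; simp [hwX, hw]
          · simp [hxw]
        have hlt : #(X \ insert w T) < N := by
          rw [← hX]
          refine card_lt_card ⟨sdiff_subset, fun h => ?_⟩
          have := h hwX
          simp at this
        have h3 := ih _ hlt (X \ insert w T) rfl w (by simp)
        rw [h2] at h3
        rw [card_insert_of_notMem hw, pow_succ, mul_assoc]
        exact (mul_le_mul_of_nonneg_left h3 (by positivity)).trans h1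
    -- All `q` extensions to `v` of good colorings of `X`; an extension fails only through an event
    -- whose support contains `v`.
    let E : Finset (V → Fin q) := (good X ×ˢ univ).image fun x => Function.update x.1 v x.2
    have hE : #E = #(good X) * q := by
      rw [card_image_of_injOn, card_product, card_univ, Fintype.card_fin]
      rintro ⟨A, i⟩ hA ⟨B, j⟩ hB hAB
      simp only [coe_product, Set.mem_prod, mem_coe, mem_good] at hA hB
      simp only at hAB
      have hij : i = j := by simpa using congrFun hAB v
      have : A = B := by
        funext p
        by_cases hp : p = v
        · rw [hp, hA.1.1 v hv, hB.1.1 v hv]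
        · simpa [hp] using congrFun hAB p
      rw [hij, this]
    choose! T hTs hTv hTm hTb using hT
    let ev : Finset ι := {e | v ∈ supp e ∧ supp e ⊆ insert v X}
    have hev : #ev ≤ k := by
      refine le_trans ?_ (hk v)
      rw [← Set.ncard_coe_finset]
      exact Set.ncard_le_ncard (fun e he => (by simpa [ev] using he : _ ∧ _).1) (Set.toFinite _)
    have hcover : E ⊆ good (insert v X) ∪ ev.biUnion fun e => {C ∈ E | bad e C} := by
      intro C hC
      by_cases hg : C ∈ good (insert v X)
      · exact mem_union_left _ hg
      refine mem_union_right _ ?_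
      obtain ⟨⟨A, i⟩, hA, rfl⟩ := mem_image.1 hC
      rw [mem_product, mem_good] at hA
      obtain ⟨⟨hA1, hA2⟩, -⟩ := hA
      rw [mem_good, not_and] at hg
      have := hg (by
        intro u hu
        simp only [mem_insert, not_or] at hu
        simpa [hu.1] using hA1 u hu.2)
      push Not at this
      obtain ⟨e, he, hbad⟩ := this
      refine mem_biUnion.2 ⟨e, ?_, mem_filter.2 ⟨hC, hbad⟩⟩
      simp only [ev, mem_filter, mem_univ, true_and]
      refine ⟨?_, he⟩
      by_contra hve
      have hsX : supp e ⊆ X := fun u hu =>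
        (mem_insert.1 (he hu)).resolve_left fun h => hve (h ▸ hu)
      refine hA2 e hsX (hloc e _ _ (fun u hu => ?_) hbad)
      have : u ≠ v := fun h => hve (h ▸ hu)
      simp [this]
    -- Erasing the colors on the decisive set `T e v` is at most `b`-to-one on extensions bad for
    -- `e` and lands in good colorings of `X` minus `m - 1` points, which `chain` compares with
    -- `good X`.
    have hbadcount : ∀ e ∈ ev, (#{C ∈ E | bad e C} : ℝ) ≤ b / β ^ (m - 1) * #(good X) := by
      intro e he
      simp only [ev, mem_filter, mem_univ, true_and] at he
      obtain ⟨hve, hsX⟩ := he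
      have hvT := hTv e v hve
      let reset : (V → Fin q) → V → Fin q := fun C p => if p ∈ T e v then c₀ else C p
      have himg : ({C ∈ E | bad e C}.image reset) ⊆ good (X \ (T e v).erase v) := by
        intro D hD
        obtain ⟨C, hC, rfl⟩ := mem_image.1 hD
        obtain ⟨⟨A, i⟩, hA, rfl⟩ := mem_image.1 (mem_filter.1 hC).1
        rw [mem_product, mem_good] at hA
        obtain ⟨⟨hA1, hA2⟩, -⟩ := hA
        rw [mem_good]
        have hout : ∀ u, u ∉ T e v → reset (Function.update A v i) u = A u := by
          intro u hu
          have : u ≠ v := fun h => hu (h ▸ hvT)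
          simp [reset, hu, this]
        refine ⟨fun u hu => ?_, fun e' he' hb' => ?_⟩
        · by_cases huT : u ∈ T e v
          · simp [reset, huT]
          · rw [hout u huT]
            refine hA1 u fun huX => hu ?_
            simp [huX, huT]
        · refine hA2 e' (he'.trans sdiff_subset) (hloc e' _ _ (fun u hu => hout u ?_) hb')
          have := mem_sdiff.1 (he' hu)
          intro huT
          refine this.2 (mem_erase.2 ⟨?_, huT⟩)
          rintro rfl
          exact hv this.1
      have hfib : #{C ∈ E | bad e C} ≤ b * #({C ∈ E | bad e C}.image reset) := by
        refine card_le_mul_card_image _ _ fun D _ => ?_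
        refine le_trans ?_ (hTb e v hve D)
        rw [← Set.ncard_coe_finset]
        refine Set.ncard_le_ncard (fun C hC => ?_) (Set.toFinite _)
        simp only [coe_filter, mem_filter, Set.mem_ofPred_eq] at hC
        obtain ⟨⟨-, hb⟩, rfl⟩ := hC
        refine ⟨fun p hp => ?_, hb⟩
        simp [reset, hp]
      have hcard : #((T e v).erase v) = m - 1 := by
        rw [card_erase_of_mem hvT, hTm e v hve]
      have hch := chain ((T e v).erase v) (fun u hu => by
        obtain ⟨huv, huT⟩ := mem_erase.1 hu
        exact (mem_insert.1 (hsX (hTs e v hve huT))).resolve_left huv)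
      rw [hcard] at hch
      have h1 : (#{C ∈ E | bad e C} : ℝ) ≤ b * #(good (X \ (T e v).erase v)) := by
        exact_mod_cast hfib.trans (Nat.mul_le_mul_left _ (card_le_card himg))
      refine h1.trans ?_
      rw [div_mul_eq_mul_div, mul_div_assoc]
      refine mul_le_mul_of_nonneg_left ?_ (by positivity)
      rw [le_div_iff₀ (by positivity)]
      linarith
    have htot : (#(good X) : ℝ) * q ≤
        #(good (insert v X)) + k * (b / β ^ (m - 1) * #(good X)) := by
      have h1 : #E ≤ #(good (insert v X)) + ∑ e ∈ ev, #{C ∈ E | bad e C} :=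
        (card_le_card hcover).trans ((card_union_le _ _).trans
          (Nat.add_le_add_left card_biUnion_le _))
      rw [hE] at h1
      have h2 : (#(good X) : ℝ) * q ≤
          #(good (insert v X)) + ∑ e ∈ ev, (#{C ∈ E | bad e C} : ℝ) := by
        exact_mod_cast h1
      refine h2.trans (add_le_add_right ?_ _)
      refine (sum_le_sum hbadcount).trans ?_
      rw [sum_const, nsmul_eq_mul]
      refine mul_le_mul_of_nonneg_right (by exact_mod_cast hev) (by positivity)
    have := mul_le_mul_of_nonneg_left hq (Nat.cast_nonneg (α := ℝ) #(good X))
    have h5 : (#(good X) : ℝ) * (β + k * b / β ^ (m - 1)) =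
      β * #(good X) + k * (b / β ^ (m - 1) * #(good X)) := by ring
    linarith
  have pos : ∀ X : Finset V, 0 < #(good X) := by
    intro X
    induction X using Finset.induction_on with
    | empty =>
      refine card_pos.2 ⟨fun _ => c₀, (mem_good _ _).2 ⟨fun _ _ => rfl, fun e he => ?_⟩⟩
      exact absurd (subset_empty.1 he) (hne e).ne_empty
    | insert v X hv ih =>
      have h1 := key _ X rfl v hv
      have h2 : (0 : ℝ) < β * #(good X) := mul_pos hβ (by exact_mod_cast ih)
      exact_mod_cast h2.trans_le h1
  obtain ⟨C, hC⟩ := card_pos.1 (pos univ)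
  exact ⟨C, fun e => ((mem_good _ _).1 hC).2 e (subset_univ _)⟩

/-! ### Line types in a projective plane and the first moment -/

section Plane

variable {P L : Type*} [Membership P L]

open Classical in
/-- If two colorings agree off `T ⊆ A` and both use every color equally often on the disjoint sets
`A` and `B`, then they use every color equally often on `T`. -/
theorem card_filter_eq_of_balanced {V : Type*} {c : ℕ} {A B T : Finset V} (hAB : Disjoint A B)
    (hTA : T ⊆ A) {C C' : V → Fin c} (hCC : ∀ p ∉ T, C p = C' p)
    (hC : ∀ i, #{p ∈ A | C p = i} = #{p ∈ B | C p = i})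
    (hC' : ∀ i, #{p ∈ A | C' p = i} = #{p ∈ B | C' p = i}) (i : Fin c) :
    #{p ∈ T | C p = i} = #{p ∈ T | C' p = i} := by
  have hB : #{p ∈ B | C p = i} = #{p ∈ B | C' p = i} := by
    congr 1
    refine filter_congr fun p hp => ?_
    rw [hCC p fun h => disjoint_left.1 hAB (hTA h) hp]
  have hD : #{p ∈ A \ T | C p = i} = #{p ∈ A \ T | C' p = i} := by
    congr 1
    refine filter_congr fun p hp => ?_
    rw [hCC p (mem_sdiff.1 hp).2]
  have split : ∀ D : V → Fin c,
      #{p ∈ A | D p = i} = #{p ∈ A \ T | D p = i} + #{p ∈ T | D p = i} := by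
    intro D
    rw [← card_union_of_disjoint (disjoint_filter_filter sdiff_disjoint), ← filter_union,
      sdiff_union_of_subset hTA]
  have h1 := split C
  have h2 := split C'
  have h3 := hC i
  have h4 := hC' i
  omega

theorem IsLegitimate.comp {c c' : ℕ} {C : P → Fin c} (hC : IsLegitimate L C)
    {φ : Fin c → Fin c'} (hφ : Function.Injective φ) : IsLegitimate L (φ ∘ C) := by
  intro l l' hl h
  refine hC l l' hl (funext fun i => ?_)
  simpa [lineType, hφ.eq_iff] using congrFun h (φ i)

open Classical in
theorem card_lines_through_pair [Fintype L] [ProjectivePlane P L] {p p' : P} (h : p ≠ p') :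
    #{l : L | p ∈ l ∧ p' ∈ l} = 1 := by
  obtain ⟨l, hl, hu⟩ := HasLines.existsUnique_line P L p p' h
  rw [card_eq_one]
  refine ⟨l, ?_⟩
  ext l'
  simp only [mem_filter, mem_univ, true_and, mem_singleton]
  exact ⟨fun h => hu l' h, fun h => h ▸ hl⟩

variable [Fintype P]

open Classical in
theorem card_line_sdiff_add_inter (l l' : L) (R : P → Prop) [DecidablePred R] :
    #{p : P | p ∈ l ∧ R p} = #{p : P | (p ∈ l ∧ p ∉ l') ∧ R p} +
      #{p : P | (p ∈ l ∧ p ∈ l') ∧ R p} := by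
  rw [← card_union_of_disjoint]
  · congr 1
    ext p
    simp only [mem_union, mem_filter, mem_univ, true_and]
    tauto
  · refine disjoint_filter.2 fun p _ h1 h2 => ?_
    tauto

open Classical in
theorem lineType_apply {c : ℕ} (C : P → Fin c) (l : L) (i : Fin c) :
    lineType C l i = #{p : P | p ∈ l ∧ C p = i} := by
  rw [lineType, ← Set.ncard_coe_finset]
  simp

open Classical in
theorem lineType_eq_iff {c : ℕ} (C : P → Fin c) (l l' : L) :
    lineType C l = lineType C l' ↔
      ∀ i, #{p ∈ ({p | p ∈ l ∧ p ∉ l'} : Finset P) | C p = i} =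
        #{p ∈ ({p | p ∈ l' ∧ p ∉ l} : Finset P) | C p = i} := by
  rw [funext_iff]
  refine forall_congr' fun i => ?_
  rw [lineType_apply, lineType_apply, card_line_sdiff_add_inter l l' (C · = i),
    card_line_sdiff_add_inter l' l (C · = i), filter_filter, filter_filter]
  have : #{p : P | (p ∈ l' ∧ p ∈ l) ∧ C p = i} = #{p : P | (p ∈ l ∧ p ∈ l') ∧ C p = i} := by
    congr 1
    ext p
    simp only [mem_filter, mem_univ, true_and]
    tauto
  omega

theorem disjoint_private (l l' : L) [DecidablePred fun p : P => p ∈ l ∧ p ∉ l']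
    [DecidablePred fun p : P => p ∈ l' ∧ p ∉ l] :
    Disjoint ({p | p ∈ l ∧ p ∉ l'} : Finset P) ({p | p ∈ l' ∧ p ∉ l} : Finset P) :=
  disjoint_filter.2 fun _ _ h1 h2 => h1.2 h2.1

open Classical in
theorem partialLineType_apply {S : Set P} {d : ℕ} (f : {p : P // p ∉ S} → Fin d) (l : L)
    (i : Fin d) :
    partialLineType f l i = #{p ∈ ({p | ∃ h : p ∉ S, f ⟨p, h⟩ = i} : Finset P) | p ∈ l} := by
  rw [partialLineType, ← Set.ncard_image_of_injective _ Subtype.val_injective,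
    ← Set.ncard_coe_finset]
  congr 1
  ext p
  simp only [Set.mem_image, coe_filter, mem_filter, mem_univ, true_and]
  constructor
  · rintro ⟨⟨x, hx⟩, ⟨h1, h2⟩, rfl⟩
    exact ⟨⟨hx, h2⟩, h1⟩
  · rintro ⟨⟨hx, h2⟩, h1⟩
    exact ⟨⟨p, hx⟩, ⟨h1, h2⟩, rfl⟩

open Classical in
theorem card_inter [ProjectivePlane P L] {l l' : L} (h : l ≠ l') : #{p : P | p ∈ l ∧ p ∈ l'} = 1 := by
  obtain ⟨p, hp, hu⟩ := HasPoints.existsUnique_point P L l l' h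
  rw [card_eq_one]
  refine ⟨p, ?_⟩
  ext p'
  simp only [mem_filter, mem_univ, true_and, mem_singleton]
  exact ⟨fun h => hu p' h, fun h => h ▸ hp⟩

variable [Fintype L] [ProjectivePlane P L]

open Classical in
theorem card_line (l : L) : #{p : P | p ∈ l} = ProjectivePlane.order P L + 1 := by
  rw [← ProjectivePlane.pointCount_eq P l, pointCount, Nat.card_eq_fintype_card,
    Fintype.card_subtype]

open Classical in
theorem card_lines_through (p : P) : #{l : L | p ∈ l} = ProjectivePlane.order P L + 1 := by
  rw [← ProjectivePlane.lineCount_eq (L := L) p, lineCount, Nat.card_eq_fintype_card,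
    Fintype.card_subtype]

open Classical in
theorem card_private {l l' : L} (h : l ≠ l') :
    #{p : P | p ∈ l ∧ p ∉ l'} = ProjectivePlane.order P L := by
  have h1 := card_line_sdiff_add_inter (P := P) l l' fun _ => True
  have h2 := card_line (P := P) l
  have h3 := card_inter (P := P) h
  simp only [and_true] at h1
  omega

open Classical in
theorem card_union {l l' : L} (h : l ≠ l') :
    #{p : P | p ∈ l ∨ p ∈ l'} = 2 * ProjectivePlane.order P L + 1 := by
  have h1 : ({p : P | p ∈ l ∨ p ∈ l'} : Finset P) =
      ({p | p ∈ l} : Finset P) ∪ ({p | p ∈ l' ∧ p ∉ l} : Finset P) := by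
    ext p
    simp only [mem_union, mem_filter, mem_univ, true_and]
    tauto
  rw [h1, card_union_of_disjoint (disjoint_filter.2 fun p _ h1 h2 => h2.2 h1), card_line,
    card_private h.symm]
  omega

open Classical in
/-- The number of colorings giving `l` and `l'` the same type. -/
theorem card_lineType_eq_le {c : ℕ} (hc : 0 < c) (q : ℕ) {l l' : L} (h : l ≠ l') :
    #{C : P → Fin c | lineType C l = lineType C l'} *
      (c ^ ProjectivePlane.order P L *
        (q.factorial ^ c * (q + 1) ^ ProjectivePlane.order P L)) ≤
    (ProjectivePlane.order P L).factorial * (q + 1) ^ (q * c) * c ^ Fintype.card P := by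
  set n := ProjectivePlane.order P L with hn
  set F : Finset (P → Fin c) := {C | lineType C l = lineType C l'}
  set W := q.factorial ^ c * (q + 1) ^ n with hW
  have hWpos : 0 < W := by positivity
  set T : Finset P := {p | p ∈ l ∧ p ∉ l'} with hT
  have hTn : #T = n := card_private h
  let c₀ : Fin c := ⟨0, hc⟩
  let reset : (P → Fin c) → P → Fin c := fun C p => if p ∈ T then c₀ else C p
  -- Once the colors off `ℓ ∖ ℓ'` are fixed, a coincidence of types prescribes the color counts on
  -- `ℓ ∖ ℓ'`, so each fiber is bounded by a multinomial coefficient.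
  have hfib : #F ≤ (n.factorial * (q + 1) ^ (q * c) / W) * #(F.image reset) := by
    refine card_le_mul_card_image _ _ fun D hD => ?_
    obtain ⟨E, hE, rfl⟩ := mem_image.1 hD
    rw [Nat.le_div_iff_mul_le hWpos]
    let κ : Fin c → ℕ := fun i => #{p ∈ T | E p = i}
    have hκ : ∑ i, κ i = n := by
      rw [← hTn]
      exact (card_eq_sum_card_fiberwise (f := E) (t := univ)
        fun _ _ => mem_coe.2 (mem_univ _)).symm
    have hsub : ({C ∈ F | reset C = reset E} : Finset (P → Fin c)) ⊆
        ({C | (∀ p ∉ T, C p = E p) ∧ ∀ i, #{p ∈ T | C p = i} = κ i} : Finset (P → Fin c)) := by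
      intro C hC
      simp only [F, mem_filter, mem_univ, true_and] at hC hE ⊢
      have hoff : ∀ p ∉ T, C p = E p := fun p hp => by
        simpa [reset, hp] using congrFun hC.2 p
      exact ⟨hoff, card_filter_eq_of_balanced (disjoint_private l l') (subset_refl _) hoff
        ((lineType_eq_iff C l l').1 hC.1) ((lineType_eq_iff E l l').1 hE)⟩
    calc #{C ∈ F | reset C = reset E} * W
        ≤ #{C : P → Fin c | (∀ p ∉ T, C p = E p) ∧ ∀ i, #{p ∈ T | C p = i} = κ i} *
          ((∏ i, (κ i).factorial) * (q + 1) ^ (q * c)) :=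
          Nat.mul_le_mul (card_le_card hsub) (factorial_pow_mul_le_prod_factorial q κ hκ)
      _ ≤ n.factorial * (q + 1) ^ (q * c) := by
          rw [← mul_assoc]
          refine Nat.mul_le_mul_right _ ?_
          rw [← hTn]
          convert card_prescribed_mul_prod_factorial_le T E κ
  have himg : #(F.image reset) * c ^ n ≤ c ^ Fintype.card P := by
    have hsub : F.image reset ⊆ Fintype.piFinset fun p => if p ∈ T then {c₀} else univ := by
      intro D hD
      obtain ⟨C, -, rfl⟩ := mem_image.1 hD
      rw [Fintype.mem_piFinset]
      intro p
      by_cases hp : p ∈ T <;> simp [reset, hp]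
    have hcard : #(Fintype.piFinset fun p => if p ∈ T then ({c₀} : Finset (Fin c)) else univ) *
        c ^ n = c ^ Fintype.card P := by
      rw [Fintype.card_piFinset, ← hTn, ← prod_const, ← card_univ, ← prod_const,
        ← prod_subset (subset_univ (T : Finset P)ᶜ) (fun p _ hp => by
          rw [mem_compl, not_not] at hp; simp [hp])]
      rw [← prod_compl_mul_prod T fun _ => c]
      congr 1
      refine prod_congr rfl fun p hp => ?_
      rw [mem_compl] at hp
      simp [hp]
    exact hcard ▸ Nat.mul_le_mul_right _ (card_le_card hsub)
  calc #F * (c ^ n * W)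
      ≤ (n.factorial * (q + 1) ^ (q * c) / W) * #(F.image reset) * (c ^ n * W) :=
        Nat.mul_le_mul_right _ hfib
    _ = (n.factorial * (q + 1) ^ (q * c) / W) * W * (#(F.image reset) * c ^ n) := by ring
    _ ≤ _ := Nat.mul_le_mul (Nat.div_mul_le_self _ _) himg

/-- First moment bound for legitimate colorings of a projective plane. -/
theorem exists_isLegitimate_of_lt (c q : ℕ)
    (h : (ProjectivePlane.order P L ^ 2 + ProjectivePlane.order P L + 1).choose 2 *
        ((ProjectivePlane.order P L).factorial * (q + 1) ^ (q * c)) <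
      c ^ ProjectivePlane.order P L *
        (q.factorial ^ c * (q + 1) ^ ProjectivePlane.order P L)) :
    ∃ C : P → Fin c, IsLegitimate L C := by
  classical
  have hn1 := ProjectivePlane.one_lt_order P L
  set n := ProjectivePlane.order P L with hn
  have hc : 0 < c := by
    rcases Nat.eq_zero_or_pos c with rfl | hc
    · rw [zero_pow (by omega)] at h
      simp at h
    · exact hc
  by_contra hcon
  push Not at hcon
  set pairs : Finset (Sym2 L) := (univ : Finset L).offDiag.image fun x => s(x.1, x.2) with hpairs
  have hcardpairs : #pairs = (n ^ 2 + n + 1).choose 2 := by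
    rw [hpairs]
    have := Sym2.card_image_offDiag (univ : Finset L)
    rw [card_univ, ProjectivePlane.card_lines P L] at this
    rw [← this]
    rfl
  set W := c ^ n * (q.factorial ^ c * (q + 1) ^ n) with hW
  have hcover : (univ : Finset (P → Fin c)) ⊆ pairs.biUnion fun z =>
      {C | ∀ l ∈ z, ∀ l' ∈ z, lineType C l = lineType C l'} := by
    intro C _
    have := hcon C
    simp only [IsLegitimate] at this
    push Not at this
    obtain ⟨l, l', hl, ht⟩ := this
    refine mem_biUnion.2 ⟨s(l, l'), mem_image.2 ⟨(l, l'), by simp [hl], rfl⟩, ?_⟩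
    simp only [mem_filter, mem_univ, true_and, Sym2.mem_iff]
    rintro a (rfl | rfl) b (rfl | rfl) <;> simp [ht]
  have hpow : 0 < c ^ Fintype.card P := by positivity
  have hsum : c ^ Fintype.card P * W ≤
      #pairs * (n.factorial * (q + 1) ^ (q * c) * c ^ Fintype.card P) := by
    have h1 : c ^ Fintype.card P = #(univ : Finset (P → Fin c)) := by
      simp
    calc c ^ Fintype.card P * W
        ≤ (∑ z ∈ pairs, #{C : P → Fin c | ∀ l ∈ z, ∀ l' ∈ z, lineType C l = lineType C l'}) *
            W := by
          rw [h1]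
          exact Nat.mul_le_mul_right _ ((card_le_card hcover).trans card_biUnion_le)
      _ ≤ ∑ z ∈ pairs, n.factorial * (q + 1) ^ (q * c) * c ^ Fintype.card P := by
          rw [sum_mul]
          refine sum_le_sum fun z hz => ?_
          obtain ⟨⟨l, l'⟩, hl, rfl⟩ := mem_image.1 hz
          have hl' : l ≠ l' := by simpa using hl
          refine le_trans (Nat.mul_le_mul_right _ (card_le_card ?_))
            (card_lineType_eq_le hc q hl')
          intro C hC
          simp only [mem_filter, mem_univ, true_and] at hC ⊢
          exact hC l (by simp) l' (by simp)
      _ = _ := by rw [sum_const, smul_eq_mul]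
  have hlt : #pairs * (n.factorial * (q + 1) ^ (q * c) * c ^ Fintype.card P) <
      c ^ Fintype.card P * W := by
    rw [← mul_assoc, mul_comm _ W]
    refine Nat.mul_lt_mul_of_pos_right ?_ hpow
    rw [hcardpairs]
    exact h
  omega

end Plane

/-! ### Second moment of line types -/

section Variance

variable {P L : Type*} [Membership P L] [Fintype P] [Fintype L] [ProjectivePlane P L]

open Classical in
theorem sum_card_line_inter (A : Finset P) :
    ∑ l : L, #{p ∈ A | p ∈ l} = (ProjectivePlane.order P L + 1) * #A := by
  simp only [card_filter]
  rw [sum_comm]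
  simp only [← card_filter, card_lines_through, sum_const, smul_eq_mul]
  ring

open Classical in
-- Counts ordered pairs of points of `A` by common lines: `1` for distinct points, `n + 1` for equal
-- ones.
theorem sum_card_line_inter_sq (A : Finset P) :
    ∑ l : L, #{p ∈ A | p ∈ l} ^ 2 = #A ^ 2 + ProjectivePlane.order P L * #A := by
  have h1 : ∀ l : L, #{p ∈ A | p ∈ l} ^ 2 =
      ∑ p ∈ A, ∑ p' ∈ A, if p ∈ l ∧ p' ∈ l then 1 else 0 := by
    intro l
    rw [sq, card_filter, sum_mul_sum]
    refine sum_congr rfl fun p _ => sum_congr rfl fun p' _ => ?_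
    by_cases hp : p ∈ l <;> by_cases hp' : p' ∈ l <;> simp [hp, hp']
  have h2 : ∀ p p' : P, #{l : L | p ∈ l ∧ p' ∈ l} =
      1 + if p = p' then ProjectivePlane.order P L else 0 := by
    intro p p'
    split_ifs with h
    · subst h
      simp only [and_self]
      rw [card_lines_through]; ring
    · rw [card_lines_through_pair h]
  simp only [h1]
  rw [sum_comm]
  simp only [sum_comm (s := univ) (t := A)]
  simp only [← card_filter, h2, sum_add_distrib, sum_const, smul_eq_mul, sum_ite_eq]
  rw [sum_ite_of_true (fun p hp => hp), sum_const, smul_eq_mul]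
  ring

open Classical in
-- Expanding gives `2 N ∑ x² - 2 (∑ x)²` with `N = n² + n + 1`; since `N < (n + 1)²`, the `|A|²`
-- terms contribute negatively and may be dropped.
theorem sum_sq_sub_card_line_inter_le (A : Finset P) :
    ∑ l : L, ∑ l' : L, ((#{p ∈ A | p ∈ l} : ℝ) - #{p ∈ A | p ∈ l'}) ^ 2 ≤
      2 * ProjectivePlane.order P L * Fintype.card L * #A := by
  have h1 : (∑ l : L, (#{p ∈ A | p ∈ l} : ℝ)) = (ProjectivePlane.order P L + 1) * #A := by
    exact_mod_cast sum_card_line_inter (L := L) A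
  have h2 : (∑ l : L, (#{p ∈ A | p ∈ l} : ℝ) ^ 2) =
      #A ^ 2 + ProjectivePlane.order P L * #A := by
    exact_mod_cast sum_card_line_inter_sq (L := L) A
  have h3 : (Fintype.card L : ℝ) =
      (ProjectivePlane.order P L : ℝ) ^ 2 + ProjectivePlane.order P L + 1 := by
    exact_mod_cast ProjectivePlane.card_lines P L
  have h4 : ∑ l : L, ∑ l' : L, ((#{p ∈ A | p ∈ l} : ℝ) - #{p ∈ A | p ∈ l'}) ^ 2 =
      2 * (Fintype.card L * (∑ l : L, (#{p ∈ A | p ∈ l} : ℝ) ^ 2)) -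
        2 * (∑ l : L, (#{p ∈ A | p ∈ l} : ℝ)) ^ 2 := by
    simp only [sub_sq, sum_add_distrib, sum_sub_distrib, sum_const, card_univ, nsmul_eq_mul,
      ← mul_sum, ← sum_mul]
    ring
  rw [h4, h1, h2, h3]
  have : (0 : ℝ) ≤ ProjectivePlane.order P L * (#A : ℝ) ^ 2 := by positivity
  nlinarith

/-- The mean square distance of line types is small. -/
theorem sum_sq_dist_partialLineType_le {S : Set P} {d : ℕ} (f : {p : P // p ∉ S} → Fin d) :
    ∑ l : L, ∑ l' : L,
        (∑ i, |(partialLineType f l i : ℝ) - (partialLineType f l' i : ℝ)|) ^ 2 ≤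
      2 * d * ProjectivePlane.order P L * Fintype.card L * Fintype.card P := by
  classical
  let A : Fin d → Finset P := fun i => {p | ∃ h : p ∉ S, f ⟨p, h⟩ = i}
  have hA : ∑ i, #(A i) ≤ Fintype.card P := by
    rw [← card_biUnion, ← card_univ]
    · exact card_le_card (subset_univ _)
    · intro i _ j _ hij
      refine disjoint_filter.2 fun p _ h1 h2 => hij ?_
      obtain ⟨h, rfl⟩ := h1
      exact h2.2
  calc ∑ l : L, ∑ l' : L,
        (∑ i, |(partialLineType f l i : ℝ) - (partialLineType f l' i : ℝ)|) ^ 2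
      ≤ ∑ l : L, ∑ l' : L,
        d * ∑ i, ((#{p ∈ A i | p ∈ l} : ℝ) - #{p ∈ A i | p ∈ l'}) ^ 2 := by
        refine sum_le_sum fun l _ => sum_le_sum fun l' _ => ?_
        refine sq_sum_le_card_mul_sum_sq.trans (le_of_eq ?_)
        simp only [sq_abs, partialLineType_apply, card_univ, Fintype.card_fin]
        rfl
    _ = d * ∑ i, ∑ l : L, ∑ l' : L,
          ((#{p ∈ A i | p ∈ l} : ℝ) - #{p ∈ A i | p ∈ l'}) ^ 2 := by
        simp only [← mul_sum]
        congr 1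
        symm
        rw [sum_comm]
        refine sum_congr rfl fun l _ => ?_
        rw [sum_comm]
    _ ≤ d * ∑ i, 2 * ProjectivePlane.order P L * Fintype.card L * (#(A i) : ℝ) := by
        gcongr with i
        exact sum_sq_sub_card_line_inter_le (A i)
    _ = 2 * d * ProjectivePlane.order P L * Fintype.card L * ((∑ i, #(A i) : ℕ) : ℝ) := by
        rw [← mul_sum]; push_cast; ring
    _ ≤ _ := by gcongr

open Classical in
-- Double counts incidences of points with dangerous pairs: a pair covers `2n + 1` points. The `2`
-- on the right passes from unordered to ordered pairs.
theorem card_isDangerous_le {S : Set P} {d k : ℕ} (f : {p : P // p ∉ S} → Fin d)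
    (hk : ∀ p : P, (dangerousPairsAt L f p).ncard ≤ k) :
    (2 * ProjectivePlane.order P L + 1) * #{x : L × L | IsDangerous f x.1 x.2} ≤
      2 * k * Fintype.card P := by
  set O : Finset (L × L) := {x | IsDangerous f x.1 x.2} with hO
  have hp : ∀ p : P, #{x ∈ O | p ∈ x.1 ∨ p ∈ x.2} ≤ 2 * k := by
    intro p
    have h1 : #{x ∈ O | p ∈ x.1 ∨ p ∈ x.2} ≤
        2 * #({x ∈ O | p ∈ x.1 ∨ p ∈ x.2}.image fun x => s(x.1, x.2)) := by
      refine card_le_mul_card_image _ _ fun z hz => ?_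
      obtain ⟨⟨a, b⟩, -, rfl⟩ := mem_image.1 hz
      refine le_trans (card_le_card (t := {(a, b), (b, a)}) ?_) card_le_two
      rintro ⟨x, y⟩ hx
      have := (mem_filter.1 hx).2
      simp only [Sym2.eq_iff] at this
      simpa using this
    refine h1.trans (Nat.mul_le_mul_left _ (le_trans ?_ (hk p)))
    rw [← Set.ncard_coe_finset]
    refine Set.ncard_le_ncard ?_ (Set.toFinite _)
    intro z hz
    obtain ⟨⟨a, b⟩, hx, rfl⟩ := mem_image.1 (mem_coe.1 hz)
    simp only [hO, mem_filter, mem_univ, true_and] at hx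
    exact ⟨a, b, rfl, hx.1, hx.2⟩
  calc (2 * ProjectivePlane.order P L + 1) * #O
      = ∑ x ∈ O, #{p : P | p ∈ x.1 ∨ p ∈ x.2} := by
        rw [sum_congr rfl fun x hx => card_union (P := P) (l := x.1) (l' := x.2)
          (by simp only [hO, mem_filter] at hx; exact hx.2.1), sum_const, smul_eq_mul, mul_comm]
    _ = ∑ p : P, #{x ∈ O | p ∈ x.1 ∨ p ∈ x.2} := by
        simp only [card_filter]
        rw [sum_comm]
    _ ≤ ∑ p : P, 2 * k := sum_le_sum fun p _ => hp p
    _ = _ := by rw [sum_const, card_univ, smul_eq_mul, mul_comm]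

/-- Few dangerous pairs and few colors force the order of the plane to be large. -/
theorem order_bound {S : Set P} {d k : ℕ} (f : {p : P // p ∉ S} → Fin d)
    (hk : ∀ p : P, (dangerousPairsAt L f p).ncard ≤ k) {n : ℕ}
    (hn : ProjectivePlane.order P L = n) :
    ((2 * n + 1) * (n * (n + 1)) - 2 * k : ℝ) * (242 * Real.log n ^ 2) ≤
      d * n * (2 * n + 1) * (n ^ 2 + n + 1) := by
  classical
  have hO := card_isDangerous_le f hk
  have hsum := sum_sq_dist_partialLineType_le (L := L) f
  have hL := ProjectivePlane.card_lines P L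
  have hP := ProjectivePlane.card_points P L
  rw [hP, hn] at hO
  rw [hL, hP, hn] at hsum
  set O : Finset (L × L) := {x | IsDangerous f x.1 x.2} with hOdef
  set R : Finset (L × L) := univ.offDiag \ O with hR
  have hOsub : O ⊆ univ.offDiag := by
    intro x hx
    simp only [hOdef, mem_filter] at hx
    simpa using hx.2.1
  have hRcard : #R + #O = (n ^ 2 + n + 1) * (n ^ 2 + n) := by
    rw [hR, card_sdiff_add_card_eq_card hOsub, offDiag_card, card_univ, hL, hn]
    have : (n ^ 2 + n + 1) * (n ^ 2 + n + 1) = (n ^ 2 + n + 1) * (n ^ 2 + n) + (n ^ 2 + n + 1) := by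
      ring
    omega
  have hlog : 0 ≤ Real.log n := Real.log_natCast_nonneg n
  -- Every pair of distinct lines that is not dangerous contributes more than `484 ln² n`; half of
  -- this constant is the final `242`.
  have hlow : (#R : ℝ) * (22 * Real.log n) ^ 2 ≤ ∑ l : L, ∑ l' : L,
      (∑ i, |(partialLineType f l i : ℝ) - (partialLineType f l' i : ℝ)|) ^ 2 := by
    rw [← sum_product', univ_product_univ, ← nsmul_eq_mul]
    refine (card_nsmul_le_sum R _ _ fun x hx => ?_).trans
      (sum_le_sum_of_subset_of_nonneg (subset_univ _) fun _ _ _ => sq_nonneg _)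
    simp only [hR, mem_sdiff, mem_offDiag, mem_univ, true_and, hOdef, mem_filter,
      IsDangerous, not_and, not_le, hn] at hx
    have := hx.2 hx.1
    gcongr
  have hO' : (2 * (n : ℝ) + 1) * #O ≤ 2 * k * ((n : ℝ) ^ 2 + n + 1) := by exact_mod_cast hO
  have hR' : (#R : ℝ) + #O = ((n : ℝ) ^ 2 + n + 1) * ((n : ℝ) ^ 2 + n) := by exact_mod_cast hRcard
  have hNpos : (0 : ℝ) < (n : ℝ) ^ 2 + n + 1 := by positivity
  push_cast at hsum
  have h1 := hlow.trans hsum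
  have h2 : ((n : ℝ) ^ 2 + n + 1) * ((2 * n + 1) * (n * (n + 1)) - 2 * k) ≤ (2 * n + 1) * #R := by
    nlinarith
  have h3 := mul_le_mul_of_nonneg_right h2 (sq_nonneg (22 * Real.log n))
  have h4 := mul_le_mul_of_nonneg_left h1 (by positivity : (0 : ℝ) ≤ 2 * n + 1)
  refine le_of_mul_le_mul_left ?_ (by positivity : (0 : ℝ) < 2 * ((n : ℝ) ^ 2 + n + 1))
  linarith

end Variance

/-! ### The first moment condition for ten and twelve colors -/

theorem two_mul_choose_le (n : ℕ) : 2 * (n ^ 2 + n + 1).choose 2 ≤ (n + 1) ^ 4 := by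
  rw [Nat.choose_two_right, Nat.add_sub_cancel]
  refine (Nat.mul_div_le _ _).trans ?_
  calc (n ^ 2 + n + 1) * (n ^ 2 + n) ≤ (n + 1) ^ 2 * (n + 1) ^ 2 := by gcongr <;> nlinarith
    _ = _ := by ring

/-- Reduces orders `c q + r` to the block start `c q`: each further unit of `r` multiplies the right
side by `c (q + 1)` and the factorial by at most that. The fourth power bounds the number of pairs
of lines throughout the block. -/
theorem first_moment_lt_of_block {c q r : ℕ} (hr : r < c)
    (h : (c * q).factorial * (c * (q + 1)) ^ 4 < 2 * c ^ (c * q) * q.factorial ^ c) :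
    ((c * q + r) ^ 2 + (c * q + r) + 1).choose 2 * ((c * q + r).factorial * (q + 1) ^ (q * c)) <
      c ^ (c * q + r) * (q.factorial ^ c * (q + 1) ^ (c * q + r)) := by
  have hle : c * q + r + 1 ≤ c * (q + 1) := by rw [mul_add]; omega
  have hfac : (c * q + r).factorial ≤ (c * q).factorial * (c * (q + 1)) ^ r := by
    rw [← Nat.factorial_mul_ascFactorial]
    refine Nat.mul_le_mul_left _ ((Nat.ascFactorial_le_pow_add _ r).trans ?_)
    exact Nat.pow_le_pow_left (by omega) r
  have hpos : 0 < (c * (q + 1)) ^ r * (q + 1) ^ (q * c) := by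
    have : 0 < c := by omega
    positivity
  refine lt_of_mul_lt_mul_left (a := 2) ?_ (by omega)
  calc 2 * (((c * q + r) ^ 2 + (c * q + r) + 1).choose 2 *
        ((c * q + r).factorial * (q + 1) ^ (q * c)))
      = 2 * ((c * q + r) ^ 2 + (c * q + r) + 1).choose 2 *
        ((c * q + r).factorial * (q + 1) ^ (q * c)) := by ring
    _ ≤ (c * (q + 1)) ^ 4 * ((c * q).factorial * (c * (q + 1)) ^ r * (q + 1) ^ (q * c)) := by
        gcongr
        exact (two_mul_choose_le _).trans (Nat.pow_le_pow_left hle 4)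
    _ = ((c * q).factorial * (c * (q + 1)) ^ 4) * ((c * (q + 1)) ^ r * (q + 1) ^ (q * c)) := by
        ring
    _ < (2 * c ^ (c * q) * q.factorial ^ c) * ((c * (q + 1)) ^ r * (q + 1) ^ (q * c)) :=
        Nat.mul_lt_mul_of_pos_right h hpos
    _ = _ := by rw [mul_pow, pow_add, pow_add, mul_comm q c]; ring

theorem block_succ {c q : ℕ} (hc : 0 < c)
    (hstep : (c * q + 1).ascFactorial c * (q + 2) ^ 4 ≤ c ^ c * (q + 1) ^ (c + 4))
    (h : (c * q).factorial * (c * (q + 1)) ^ 4 < 2 * c ^ (c * q) * q.factorial ^ c) :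
    (c * (q + 1)).factorial * (c * (q + 1 + 1)) ^ 4 <
      2 * c ^ (c * (q + 1)) * (q + 1).factorial ^ c := by
  calc (c * (q + 1)).factorial * (c * (q + 1 + 1)) ^ 4
      = (c * q).factorial * c ^ 4 * ((c * q + 1).ascFactorial c * (q + 2) ^ 4) := by
        rw [mul_add c q 1, mul_one, ← Nat.factorial_mul_ascFactorial]; ring
    _ ≤ (c * q).factorial * c ^ 4 * (c ^ c * (q + 1) ^ (c + 4)) := Nat.mul_le_mul_left _ hstep
    _ = ((c * q).factorial * (c * (q + 1)) ^ 4) * (c ^ c * (q + 1) ^ c) := by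
        rw [pow_add]; ring
    _ < (2 * c ^ (c * q) * q.factorial ^ c) * (c ^ c * (q + 1) ^ c) :=
        Nat.mul_lt_mul_of_pos_right h (by positivity)
    _ = _ := by rw [Nat.factorial_succ, mul_pow, mul_add c q 1, mul_one, pow_add]; ring

theorem block_twelve {q : ℕ} (hq : 3 ≤ q) :
    (12 * q).factorial * (12 * (q + 1)) ^ 4 < 2 * 12 ^ (12 * q) * q.factorial ^ 12 := by
  induction q, hq using Nat.le_induction with
  | base => norm_num [Nat.factorial]
  | succ q _ ih =>
    refine block_succ (by omega) ?_ ih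
    simp only [Nat.ascFactorial]
    -- Both sides become polynomials in `q` that compare coefficient by coefficient.
    ring_nf
    gcongr <;> norm_num

set_option exponentiation.threshold 500 in
theorem block_ten {q : ℕ} (hq : 40 ≤ q) :
    (10 * q).factorial * (10 * (q + 1)) ^ 4 < 2 * 10 ^ (10 * q) * q.factorial ^ 10 := by
  induction q, hq using Nat.le_induction with
  | base => norm_num [Nat.factorial]
  | succ q _ ih =>
    refine block_succ (by omega) ?_ ih
    simp only [Nat.ascFactorial]
    ring_nf
    gcongr <;> norm_num

theorem first_moment_lt_twelve_of_lt {n : ℕ} (h2 : 2 ≤ n) (hn : n < 36) :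
    (n ^ 2 + n + 1).choose 2 * (n.factorial * (n / 12 + 1) ^ (n / 12 * 12)) <
      12 ^ n * ((n / 12).factorial ^ 12 * (n / 12 + 1) ^ n) := by
  interval_cases n <;> norm_num [Nat.factorial, Nat.choose_two_right]

theorem first_moment_lt_twelve {n : ℕ} (h2 : 2 ≤ n) :
    (n ^ 2 + n + 1).choose 2 * (n.factorial * (n / 12 + 1) ^ (n / 12 * 12)) <
      12 ^ n * ((n / 12).factorial ^ 12 * (n / 12 + 1) ^ n) := by
  rcases lt_or_ge n 36 with h | h
  · exact first_moment_lt_twelve_of_lt h2 h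
  · have := first_moment_lt_of_block (Nat.mod_lt n (by omega : 12 > 0))
      (block_twelve (q := n / 12) (by omega))
    rwa [Nat.div_add_mod] at this

theorem first_moment_lt_ten {n : ℕ} (h : 400 ≤ n) :
    (n ^ 2 + n + 1).choose 2 * (n.factorial * (n / 10 + 1) ^ (n / 10 * 10)) <
      10 ^ n * ((n / 10).factorial ^ 10 * (n / 10 + 1) ^ n) := by
  have := first_moment_lt_of_block (Nat.mod_lt n (by omega : 10 > 0))
    (block_ten (q := n / 10) (by omega))
  rwa [Nat.div_add_mod] at this

/-! ### Which terms of the entropy bound matter -/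

theorem entropyTerm_le_iff {m k : ℕ} {x : ℝ} (hm : 2 ≤ m) (hx : 0 ≤ x) :
    (m : ℝ) / ((m : ℝ) - 1) * ((m.factorial : ℝ) * k * ((m : ℝ) - 1)) ^ (1 / (m : ℝ)) ≤ x ↔
      (m.factorial : ℝ) * k * ((m : ℝ) - 1) ≤ (x * ((m : ℝ) - 1) / m) ^ m := by
  have hm' : (2 : ℝ) ≤ m := by exact_mod_cast hm
  have h1 : (0 : ℝ) < (m : ℝ) - 1 := by linarith
  have h0 : (0 : ℝ) < m := by linarith
  have hY : (0 : ℝ) ≤ (m.factorial : ℝ) * k * ((m : ℝ) - 1) := by positivity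
  rw [one_div, div_mul_eq_mul_div, div_le_iff₀ h1, mul_comm, ← le_div_iff₀ h0,
    Real.rpow_inv_le_iff_of_pos hY (by positivity) h0, Real.rpow_natCast]

/-- For `x ≤ m + 2` the bound imposed on `k` by index `m + 1` is no weaker than the one by `m`. The
comparison reduces to `hkey`, where `(m - 1)(m + 1) = m² - 1` and Bernoulli's inequality handle the
powers. -/
theorem entropyTerm_le_of_succ {m k : ℕ} {x : ℝ} (hm : 2 ≤ m) (hx : 0 ≤ x) (hxm : x ≤ m + 2)
    (h : ((m + 1).factorial : ℝ) * k * (((m + 1 : ℕ) : ℝ) - 1) ≤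
      (x * (((m + 1 : ℕ) : ℝ) - 1) / ((m + 1 : ℕ) : ℝ)) ^ (m + 1)) :
    (m.factorial : ℝ) * k * ((m : ℝ) - 1) ≤ (x * ((m : ℝ) - 1) / m) ^ m := by
  obtain ⟨t, rfl⟩ : ∃ t, m = t + 1 := ⟨m - 1, by omega⟩
  have ht : (1 : ℝ) ≤ t := by
    have : 1 ≤ t := by omega
    exact_mod_cast this
  set M : ℝ := (t : ℝ) + 1 with hM
  have hM0 : 0 < M := by linarith
  push_cast at h hxm ⊢
  rw [Nat.factorial_succ (t + 1)] at h
  push_cast at h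
  rw [← hM] at h hxm ⊢
  set F : ℝ := ((t + 1).factorial : ℝ) * k with hF
  have hF0 : 0 ≤ F := by positivity
  have hbern : 1 - t / M ^ 2 ≤ (1 - 1 / M ^ 2) ^ t := by
    have h1 : -2 ≤ -(1 / M ^ 2) := by
      have : 1 / M ^ 2 ≤ 1 := by
        rw [div_le_one (by positivity)]
        nlinarith
      linarith
    have := one_add_mul_le_pow h1 t
    calc 1 - t / M ^ 2 = 1 + t * -(1 / M ^ 2) := by ring
      _ ≤ _ := this
      _ = _ := by rw [← sub_eq_add_neg]
  have hpoly : x * M ^ 4 ≤ (M ^ 2 - t) * (M + 1) ^ 3 := by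
    have h1 : x * M ^ 4 ≤ (M + 2) * M ^ 4 := mul_le_mul_of_nonneg_right hxm (by positivity)
    have h2 : (t : ℝ) = M - 1 := by rw [hM]; ring
    rw [h2]
    nlinarith [pow_pos hM0 2, pow_pos hM0 3]
  have hkey : x * M ^ (2 * t + 2) ≤ (M + 1) ^ (t + 3) * (t : ℝ) ^ t := by
    have h1 : (t : ℝ) * (M + 1) = M ^ 2 * (1 - 1 / M ^ 2) := by
      field_simp
      rw [hM]; ring
    calc x * M ^ (2 * t + 2) = (x * M ^ 4) * (M ^ (2 * t) / M ^ 2) := by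
          rw [pow_add]; field_simp
      _ ≤ ((M ^ 2 - t) * (M + 1) ^ 3) * (M ^ (2 * t) / M ^ 2) := by gcongr
      _ = M ^ (2 * t) * (1 - t / M ^ 2) * (M + 1) ^ 3 := by field_simp
      _ ≤ M ^ (2 * t) * (1 - 1 / M ^ 2) ^ t * (M + 1) ^ 3 := by gcongr
      _ = (M + 1) ^ (t + 3) * (t : ℝ) ^ t := by
          rw [pow_mul, ← mul_pow, ← h1, mul_pow, pow_add]; ring
  have h' : F * (M + 1) ^ (t + 3) * M ≤ x ^ (t + 2) * M ^ (t + 2) := by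
    have h2 : (M + 1) * ((t + 1).factorial : ℝ) * k * (M + 1 - 1) = (M + 1) * F * M := by
      rw [hF]; ring
    rw [h2, add_sub_cancel_right, div_pow, le_div_iff₀ (by positivity), mul_pow] at h
    calc _ = (M + 1) * F * M * (M + 1) ^ (t + 1 + 1) := by ring
      _ ≤ _ := h
  rw [show M - 1 = (t : ℝ) by rw [hM]; ring, div_pow, le_div_iff₀ (by positivity), mul_pow]
  refine le_of_mul_le_mul_right ?_ (by positivity : 0 < (M + 1) ^ (t + 3) * M)
  calc F * t * M ^ (t + 1) * ((M + 1) ^ (t + 3) * M)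
      = (F * (M + 1) ^ (t + 3) * M) * (t * M ^ (t + 1)) := by ring
    _ ≤ (x ^ (t + 2) * M ^ (t + 2)) * (t * M ^ (t + 1)) := by gcongr
    _ = x ^ (t + 1) * t * M * (x * M ^ (2 * t + 2)) := by ring
    _ ≤ x ^ (t + 1) * t * M * ((M + 1) ^ (t + 3) * (t : ℝ) ^ t) := by gcongr
    _ = _ := by ring

theorem entropyTerm_le_of_le {M m k : ℕ} {x : ℝ} (hM : 2 ≤ M) (hx : 0 ≤ x) (hxM : x ≤ M + 2)
    (hm : M ≤ m) (h : (m.factorial : ℝ) * k * ((m : ℝ) - 1) ≤ (x * ((m : ℝ) - 1) / m) ^ m) :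
    (M.factorial : ℝ) * k * ((M : ℝ) - 1) ≤ (x * ((M : ℝ) - 1) / M) ^ M := by
  induction m, hm using Nat.le_induction with
  | base => exact h
  | succ m hm ih =>
    refine ih (entropyTerm_le_of_succ (hM.trans hm) hx (hxM.trans ?_) h)
    have : (M : ℝ) ≤ m := by exact_mod_cast hm
    linarith

/-- The infimum defining `entropyBound` is attained at a small index. -/
theorem exists_entropyTerm_le {k q M : ℕ} (hM : 2 ≤ M) (hqM : q ≤ M + 2)
    (h : entropyBound k ≤ q) :
    ∃ m, 2 ≤ m ∧ m ≤ M ∧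
      (m.factorial : ℝ) * k * ((m : ℝ) - 1) ≤ ((q : ℝ) * ((m : ℝ) - 1) / m) ^ m := by
  let g : ℕ → ℝ := fun m =>
    (m : ℝ) / ((m : ℝ) - 1) * ((m.factorial : ℝ) * k * ((m : ℝ) - 1)) ^ (1 / (m : ℝ))
  have hg0 : ∀ m, 2 ≤ m → 0 ≤ g m := by
    intro m hm
    have hm' : (2 : ℝ) ≤ m := by exact_mod_cast hm
    have h1 : (0 : ℝ) < (m : ℝ) - 1 := by linarith
    simp only [g]
    positivity
  obtain ⟨m₀, hm₀, hmin⟩ := Finset.exists_min_image (Finset.Icc 2 (M + 1)) g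
    ⟨2, by simp; omega⟩
  rw [Finset.mem_Icc] at hm₀
  have hgm₀ : g m₀ ≤ q := by
    by_contra hcon
    push Not at hcon
    -- The infimum is over infinitely many indices, so only an approximate minimizer is available.
    -- Its value stays below `q + 1 ≤ M + 3`, which still allows descent to index `M + 1`.
    have hlt : entropyBound k < min (g m₀) (q + 1) :=
      h.trans_lt (lt_min hcon (by linarith))
    obtain ⟨⟨m, hm⟩, hgm⟩ := exists_lt_of_ciInf_lt hlt
    replace hgm : g m < min (g m₀) (q + 1) := hgm
    obtain ⟨ha, hb⟩ := lt_min_iff.1 hgm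
    rcases le_or_gt m (M + 1) with hmM | hmM
    · exact absurd (hmin m (Finset.mem_Icc.2 ⟨hm, hmM⟩)) (not_le.2 ha)
    · have h1 := (entropyTerm_le_iff (k := k) hm (hg0 m hm)).1 le_rfl
      have hqM' : (q : ℝ) ≤ M + 2 := by exact_mod_cast hqM
      have h2 := entropyTerm_le_of_le (M := M + 1) (by omega) (hg0 m hm)
        (by push_cast; linarith) hmM.le h1
      have h3 : g (M + 1) ≤ g m := (entropyTerm_le_iff (by omega) (hg0 m hm)).2 h2
      have h4 := hmin (M + 1) (Finset.mem_Icc.2 ⟨by omega, le_rfl⟩)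
      linarith
  have h1 := (entropyTerm_le_iff (k := k) hm₀.1 (Nat.cast_nonneg q)).1 hgm₀
  rcases le_or_gt m₀ M with hle | hlt
  · exact ⟨m₀, hm₀.1, hle, h1⟩
  · exact ⟨M, hM, le_rfl, entropyTerm_le_of_le hM (Nat.cast_nonneg q) (by exact_mod_cast hqM)
      hlt.le h1⟩

theorem le_of_entropyBound_le_seven {k : ℕ} (h : entropyBound k ≤ (7 : ℕ)) : k ≤ 11 := by
  obtain ⟨m, h2, hm, h⟩ := exists_entropyTerm_le (M := 5) (by omega) (by omega) h
  have : (k : ℝ) < 12 := by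
    interval_cases m <;> norm_num [Nat.factorial] at h <;> linarith
  have : k < 12 := by exact_mod_cast this
  omega

theorem le_of_entropyBound_le_eight {k : ℕ} (h : entropyBound k ≤ (8 : ℕ)) : k ≤ 24 := by
  obtain ⟨m, h2, hm, h⟩ := exists_entropyTerm_le (M := 6) (by omega) (by omega) h
  have : (k : ℝ) < 25 := by
    interval_cases m <;> norm_num [Nat.factorial] at h <;> linarith
  have : k < 25 := by exact_mod_cast this
  omega

theorem le_of_entropyBound_le_nine {k : ℕ} (h : entropyBound k ≤ (9 : ℕ)) : k ≤ 53 := by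
  obtain ⟨m, h2, hm, h⟩ := exists_entropyTerm_le (M := 7) (by omega) (by omega) h
  have : (k : ℝ) < 54 := by
    interval_cases m <;> norm_num [Nat.factorial] at h <;> linarith
  have : k < 54 := by exact_mod_cast this
  omega

theorem le_of_entropyBound_le_eleven {k : ℕ} (h : entropyBound k ≤ (11 : ℕ)) : k ≤ 281 := by
  obtain ⟨m, h2, hm, h⟩ := exists_entropyTerm_le (M := 9) (by omega) (by omega) h
  have : (k : ℝ) < 282 := by
    interval_cases m <;> norm_num [Nat.factorial] at h <;> linarith
  have : k < 282 := by exact_mod_cast this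
  omega

/-! ### Excluding ranges of small orders -/

/-- Turns the second moment inequality into integer arithmetic on a window `a ≤ n ≤ b`. Here `116 j
^ 2` bounds `242 ln² n` from below, `g` is its slack over `D b`, and the resulting inequality need
only fail at `n = a`, by monotonicity. -/
theorem order_bound_contradiction {n k d : ℕ} (j a b D K g : ℕ)
    (h : ((2 * n + 1) * (n * (n + 1)) - 2 * k : ℝ) * (242 * Real.log n ^ 2) ≤
      d * n * (2 * n + 1) * (n ^ 2 + n + 1))
    (han : a ≤ n) (hnb : n ≤ b) (hd : d ≤ D) (hk : k ≤ K) (hj : 2 ^ j ≤ a)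
    (hg : D * b + g ≤ 116 * j ^ 2)
    (hnum : 2 * K * (116 * j ^ 2) + a * (2 * a + 1) * D < a * (2 * a + 1) * ((a + 1) * g)) :
    False := by
  have han' : (a : ℝ) ≤ n := by exact_mod_cast han
  have hnb' : (n : ℝ) ≤ b := by exact_mod_cast hnb
  have hd' : (d : ℝ) ≤ D := by exact_mod_cast hd
  have hk' : (k : ℝ) ≤ K := by exact_mod_cast hk
  have hg' : (D : ℝ) * b + g ≤ 116 * (j : ℝ) ^ 2 := by exact_mod_cast hg
  have hnum' : 2 * (K : ℝ) * (116 * (j : ℝ) ^ 2) + a * (2 * a + 1) * D <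
      a * (2 * a + 1) * ((a + 1) * g) := by exact_mod_cast hnum
  have hlog : (j : ℝ) * 0.693 ≤ Real.log n := by
    have h1 : Real.log ((2 : ℝ) ^ j) ≤ Real.log n := by
      refine Real.log_le_log (by positivity) ?_
      exact_mod_cast hj.trans han
    rw [Real.log_pow] at h1
    have := Real.log_two_gt_d9
    have h2 : (j : ℝ) * 0.693 ≤ j * Real.log 2 := by gcongr; linarith
    linarith
  set c : ℝ := 116 * (j : ℝ) ^ 2 with hc
  have hc0 : 0 ≤ c := by positivity
  -- `242 · 0.693² > 116`.
  have hy : c ≤ 242 * Real.log n ^ 2 := by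
    have : ((j : ℝ) * 0.693) ^ 2 ≤ Real.log n ^ 2 := by gcongr
    nlinarith [sq_nonneg (j : ℝ)]
  have hgc : (g : ℝ) ≤ c := by
    have : (0 : ℝ) ≤ (D : ℝ) * b := by positivity
    linarith
  have hcpos : 0 < c := by
    rcases hc0.lt_or_eq with h0 | h0
    · exact h0
    · have hg0 : (g : ℝ) = 0 := le_antisymm (h0 ▸ hgc) (by positivity)
      rw [hg0, ← h0] at hnum'
      have : (0 : ℝ) ≤ a * (2 * a + 1) * D := by positivity
      linarith
  have hX : (0 : ℝ) ≤ (2 * n + 1) * (n * (n + 1)) - 2 * k := by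
    have h1 : 2 * (K : ℝ) * c ≤ ((2 * n + 1) * (n * (n + 1))) * c := by
      calc 2 * (K : ℝ) * c ≤ a * (2 * a + 1) * ((a + 1) * g) := by
            have : (0 : ℝ) ≤ a * (2 * a + 1) * D := by positivity
            linarith
        _ ≤ n * (2 * n + 1) * ((n + 1) * c) := by gcongr
        _ = _ := by ring
    have := le_of_mul_le_mul_right h1 hcpos
    linarith
  have h1 : ((2 * n + 1) * (n * (n + 1)) - 2 * K : ℝ) * c ≤
      D * n * (2 * n + 1) * (n ^ 2 + n + 1) := by
    calc ((2 * n + 1) * (n * (n + 1)) - 2 * K : ℝ) * c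
        ≤ ((2 * n + 1) * (n * (n + 1)) - 2 * k : ℝ) * c := by gcongr
      _ ≤ ((2 * n + 1) * (n * (n + 1)) - 2 * k : ℝ) * (242 * Real.log n ^ 2) := by gcongr
      _ ≤ d * n * (2 * n + 1) * (n ^ 2 + n + 1) := h
      _ ≤ _ := by gcongr
  have hcn : (D : ℝ) * n + g ≤ c := by
    have : (D : ℝ) * n ≤ D * b := by gcongr
    linarith
  have h2 : (n : ℝ) * (2 * n + 1) * ((n + 1) * g - D) ≤ 2 * K * c := by
    have h3 := mul_le_mul_of_nonneg_left hcn
      (by positivity : (0 : ℝ) ≤ (n : ℝ) * (2 * n + 1) * (n + 1))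
    linarith
  have hpos : (0 : ℝ) ≤ (a + 1) * g - D := by
    by_contra hneg
    push Not at hneg
    have h4 : (a : ℝ) * (2 * a + 1) * ((a + 1) * g - D) ≤ 0 :=
      mul_nonpos_of_nonneg_of_nonpos (by positivity) hneg.le
    have h5 : 0 ≤ 2 * (K : ℝ) * c := by positivity
    linarith
  have h3 : (a : ℝ) * (2 * a + 1) * ((a + 1) * g - D) ≤
      n * (2 * n + 1) * ((n + 1) * g - D) := by gcongr
  linarith

/-! ### Extending the partial coloring over `S` -/

section Extension

variable {P L : Type*} [Membership P L]

open Classical in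
/-- The coloring of all points that is `C` on `S` and `f` off `S`. -/
noncomputable def extend {S : Set P} {d q : ℕ} (hd : d ≤ q) (f : {p : P // p ∉ S} → Fin d) (C : P → Fin q) :
    P → Fin q :=
  fun p => if h : p ∈ S then C p else Fin.castLE hd (f ⟨p, h⟩)

variable {S : Set P} {d q : ℕ} (hd : d ≤ q) (f : {p : P // p ∉ S} → Fin d)

theorem extend_of_mem (C : P → Fin q) {p : P} (h : p ∈ S) : extend hd f C p = C p := by
  simp [extend, h]

theorem extend_congr {C C' : P → Fin q} {p : P} (h : p ∈ S → C p = C' p) :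
    extend hd f C p = extend hd f C' p := by
  by_cases hp : p ∈ S <;> simp [extend, hp, h]

variable [Fintype P]

open Classical in
theorem lineType_extend (C : P → Fin q) (l : L) (i : Fin d) :
    lineType (extend hd f C) l (Fin.castLE hd i) =
      partialLineType f l i + #{p : P | (p ∈ l ∧ p ∈ S) ∧ C p = Fin.castLE hd i} := by
  rw [lineType_apply, partialLineType_apply, ← card_union_of_disjoint]
  · congr 1
    ext p
    simp only [mem_union, mem_filter, mem_univ, true_and]
    by_cases hp : p ∈ S
    · simp [extend, hp]
    · simp only [extend, hp, not_false_eq_true, exists_true_left, dif_neg, and_false, false_and,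
        or_false, Fin.castLE_inj]
      tauto
  · refine disjoint_left.2 fun p h1 h2 => ?_
    simp only [mem_filter, mem_univ, true_and] at h1 h2
    exact h1.1.1 h2.1.2

open Classical in
-- Any two such colorings have the same color counts on `T`, hence there are at most as many as
-- arrangements of `m` objects.
theorem ncard_lineType_extend_eq_le {m : ℕ} {l l' : L} {T : Finset P} (hTm : #T = m)
    (hT : T ⊆ ({p | (p ∈ l ∧ p ∉ l') ∧ p ∈ S} : Finset P)) (C₀ : P → Fin q) :
    {C : P → Fin q | (∀ p ∉ T, C p = C₀ p) ∧
      lineType (extend hd f C) l = lineType (extend hd f C) l'}.ncard ≤ m.factorial := by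
  set F := {C : P → Fin q | (∀ p ∉ T, C p = C₀ p) ∧
    lineType (extend hd f C) l = lineType (extend hd f C) l'} with hF
  rcases F.eq_empty_or_nonempty with h0 | ⟨E, hE⟩
  · simp [h0]
  have hmemS : ∀ p ∈ T, p ∈ S := fun p hp => by
    have := hT hp
    simp only [mem_filter, mem_univ, true_and] at this
    exact this.2
  have hTA : T ⊆ ({p | p ∈ l ∧ p ∉ l'} : Finset P) := fun p hp => by
    have := hT hp
    simp only [mem_filter, mem_univ, true_and] at this ⊢
    exact this.1
  have hext : ∀ (C : P → Fin q) (i : Fin q),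
      #{p ∈ T | extend hd f C p = i} = #{p ∈ T | C p = i} := by
    intro C i
    congr 1
    refine filter_congr fun p hp => ?_
    rw [extend_of_mem hd f C (hmemS p hp)]
  have hsub : F ⊆ (({C | (∀ p ∉ T, C p = E p) ∧
      ∀ i, #{p ∈ T | C p = i} = #{p ∈ T | E p = i}} : Finset (P → Fin q)) : Set (P → Fin q)) := by
    rintro C ⟨hC1, hC2⟩
    simp only [coe_filter, mem_univ, true_and]
    have hoff : ∀ p ∉ T, C p = E p := fun p hp => (hC1 p hp).trans (hE.1 p hp).symm
    refine ⟨hoff, fun i => ?_⟩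
    rw [← hext C, ← hext E]
    exact card_filter_eq_of_balanced (disjoint_private l l') hTA
      (fun p hp => extend_congr hd f fun _ => hoff p hp)
      ((lineType_eq_iff _ l l').1 hC2) ((lineType_eq_iff _ l l').1 hE.2) i
  refine (Set.ncard_le_ncard hsub (Set.toFinite _)).trans ?_
  rw [Set.ncard_coe_finset, ← hTm]
  refine le_trans (Nat.le_mul_of_pos_right _ ?_)
    (card_prescribed_mul_prod_factorial_le T E fun i => #{p ∈ T | E p = i})
  exact prod_pos fun i _ => Nat.factorial_pos _

variable [ProjectivePlane P L]

/-- When the full types agree, the partial ones differ only by the contributions of `S`, at most `11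
ln n` from each line. -/
theorem isDangerous_of_lineType_extend_eq (hS : IsReserved L S) {C : P → Fin q} {l l' : L}
    (hl : l ≠ l') (h : lineType (extend hd f C) l = lineType (extend hd f C) l') :
    IsDangerous f l l' := by
  classical
  refine ⟨hl, ?_⟩
  have hsum : ∀ x : L, ∑ i : Fin d, #{p : P | (p ∈ x ∧ p ∈ S) ∧ C p = Fin.castLE hd i} ≤
      {p : P | p ∈ x ∧ p ∈ S}.ncard := by
    intro x
    rw [← card_biUnion, ← Set.ncard_coe_finset]
    · refine Set.ncard_le_ncard (fun p hp => ?_) (Set.toFinite _)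
      simp only [coe_biUnion, Set.mem_iUnion, coe_filter, mem_univ, true_and] at hp
      obtain ⟨i, -, hp⟩ := hp
      exact hp.1
    · intro i _ j _ hij
      refine disjoint_filter.2 fun p _ h1 h2 => hij ?_
      exact Fin.castLE_injective hd (h1.2.symm.trans h2.2)
  have hsum' : ∀ x : L, ∑ i : Fin d,
      (#{p : P | (p ∈ x ∧ p ∈ S) ∧ C p = Fin.castLE hd i} : ℝ) ≤
        11 * Real.log (ProjectivePlane.order P L) := by
    intro x
    refine le_trans ?_ (hS x).2
    exact_mod_cast hsum x
  calc ∑ i, |(partialLineType f l i : ℝ) - (partialLineType f l' i : ℝ)|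
      ≤ ∑ i : Fin d, ((#{p : P | (p ∈ l ∧ p ∈ S) ∧ C p = Fin.castLE hd i} : ℝ) +
          #{p : P | (p ∈ l' ∧ p ∈ S) ∧ C p = Fin.castLE hd i}) := by
        refine sum_le_sum fun i _ => ?_
        have h1 := lineType_extend hd f C l i
        have h2 := lineType_extend hd f C l' i
        rw [h, h2] at h1
        have h3 : (partialLineType f l' i : ℝ) +
            #{p : P | (p ∈ l' ∧ p ∈ S) ∧ C p = Fin.castLE hd i} = partialLineType f l i +
            #{p : P | (p ∈ l ∧ p ∈ S) ∧ C p = Fin.castLE hd i} := by exact_mod_cast h1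
        have h4 : (0 : ℝ) ≤ #{p : P | (p ∈ l' ∧ p ∈ S) ∧ C p = Fin.castLE hd i} := by positivity
        have h5 : (0 : ℝ) ≤ #{p : P | (p ∈ l ∧ p ∈ S) ∧ C p = Fin.castLE hd i} := by positivity
        rw [abs_le]
        constructor <;> linarith
    _ ≤ 22 * Real.log (ProjectivePlane.order P L) := by
        rw [sum_add_distrib]
        linarith [hsum' l, hsum' l']

open Classical in
-- Strictness of `m < ln n` gives `m + 1` reserved points on `ℓ`, of which at most one lies on `ℓ'`.
theorem le_card_reserved_private (hS : IsReserved L S) {m : ℕ}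
    (hm : (m : ℝ) < Real.log (ProjectivePlane.order P L)) {l l' : L} (hl : l ≠ l') :
    m ≤ #{p : P | (p ∈ l ∧ p ∉ l') ∧ p ∈ S} := by
  have h1 : m < #{p : P | p ∈ l ∧ p ∈ S} := by
    have h2 := hm.trans_le (hS l).1
    rw [Nat.cast_lt] at h2
    rw [← Set.ncard_coe_finset]
    simpa using h2
  have h2 := card_line_sdiff_add_inter l l' (· ∈ S)
  have h3 : #{p : P | (p ∈ l ∧ p ∈ l') ∧ p ∈ S} ≤ 1 := by
    rw [← card_inter (P := P) hl]
    refine card_le_card fun p hp => ?_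
    simp only [mem_filter, mem_univ, true_and] at hp ⊢
    exact hp.1
  omega

theorem exists_isLegitimate_of_entropyTerm_le [Fintype L] {d q : ℕ} (hd : d ≤ q)
    (f : {p : P // p ∉ S} → Fin d) (hS : IsReserved L S) {k m : ℕ}
    (hk : ∀ p : P, (dangerousPairsAt L f p).ncard ≤ k) (hm2 : 2 ≤ m)
    (hm : (m : ℝ) < Real.log (ProjectivePlane.order P L)) (hq : 0 < q)
    (hE : (m.factorial : ℝ) * k * ((m : ℝ) - 1) ≤ ((q : ℝ) * ((m : ℝ) - 1) / m) ^ m) :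
    ∃ C : P → Fin q, IsLegitimate L C := by
  classical
  let ι := {z : Sym2 L // ∃ l l', z = s(l, l') ∧ IsDangerous f l l'}
  -- The reserved part of the symmetric difference of the two lines: points on both never affect
  -- whether the types agree.
  let supp : ι → Finset P := fun z =>
    {p | p ∈ S ∧ (∃ l ∈ z.1, p ∈ l) ∧ ∃ l ∈ z.1, p ∉ l}
  let bad : ι → (P → Fin q) → Prop := fun z C =>
    ∀ l l', z.1 = s(l, l') → lineType (extend hd f C) l = lineType (extend hd f C) l'
  have hm' : (2 : ℝ) ≤ m := by exact_mod_cast hm2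
  have hm1 : (0 : ℝ) < (m : ℝ) - 1 := by linarith
  have hm0 : (0 : ℝ) < m := by linarith
  have hq' : (0 : ℝ) < q := by exact_mod_cast hq
  have mem_supp : ∀ (z : ι) {l l' : L}, z.1 = s(l, l') → ∀ {p : P}, p ∈ S → p ∈ l → p ∉ l' →
      p ∈ supp z := by
    intro z l l' hz p hpS hpl hpl'
    simp only [supp, mem_filter, mem_univ, true_and, hz]
    exact ⟨hpS, ⟨l, by simp, hpl⟩, ⟨l', by simp, hpl'⟩⟩
  have havoid := exists_coloring_avoiding (q := q) (m := m) (k := k) (b := m.factorial)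
    (β := (q : ℝ) * ((m : ℝ) - 1) / m) (by positivity) supp bad ?_ ?_ ?_ ?_ ?_
  · obtain ⟨C, hC⟩ := havoid
    refine ⟨extend hd f C, fun l l' hl h => ?_⟩
    have hdang := isDangerous_of_lineType_extend_eq hd f hS hl h
    refine hC ⟨s(l, l'), l, l', rfl, hdang⟩ fun a b hab => ?_
    rcases Sym2.eq_iff.1 hab with ⟨rfl, rfl⟩ | ⟨rfl, rfl⟩
    · exact h
    · exact h.symm
  · rintro ⟨z, l, l', rfl, hll⟩
    have := le_card_reserved_private hS hm hll.1
    obtain ⟨p, hp⟩ := card_pos.1 (by omega : 0 < #{p : P | (p ∈ l ∧ p ∉ l') ∧ p ∈ S})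
    simp only [mem_filter, mem_univ, true_and] at hp
    exact ⟨p, mem_supp _ rfl hp.2 hp.1.1 hp.1.2⟩
  · intro z C C' hCC hbad l l' hz
    have hcongr : ∀ {a b : L}, z.1 = s(a, b) → ∀ i,
        #{p ∈ ({p | p ∈ a ∧ p ∉ b} : Finset P) | extend hd f C' p = i} =
        #{p ∈ ({p | p ∈ a ∧ p ∉ b} : Finset P) | extend hd f C p = i} := by
      intro a b hab i
      congr 1
      refine filter_congr fun p hp => ?_
      simp only [mem_filter, mem_univ, true_and] at hp
      rw [extend_congr hd f fun hpS => (hCC p (mem_supp z hab hpS hp.1 hp.2)).symm]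
    rw [lineType_eq_iff]
    intro i
    rw [hcongr hz, hcongr (hz.trans Sym2.eq_swap)]
    exact (lineType_eq_iff _ l l').1 (hbad l l' hz) i
  · intro v
    refine le_trans ?_ (hk v)
    rw [← Set.ncard_image_of_injective _ Subtype.val_injective]
    refine Set.ncard_le_ncard ?_ (Set.toFinite _)
    rintro _ ⟨⟨z, l, l', rfl, hll⟩, hv, rfl⟩
    refine ⟨l, l', rfl, hll, ?_⟩
    replace hv : v ∈ supp _ := hv
    simp only [supp, mem_filter, mem_univ, true_and, Sym2.mem_iff] at hv
    obtain ⟨-, ⟨x, rfl | rfl, hx⟩, -⟩ := hv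
    · exact Or.inl hx
    · exact Or.inr hx
  · intro z v hv
    have hv' := hv
    simp only [supp, mem_filter, mem_univ, true_and] at hv'
    obtain ⟨hvS, ⟨x, hxz, hvx⟩, ⟨y, hyz, hvy⟩⟩ := hv'
    have hxy : x ≠ y := fun h => hvy (h ▸ hvx)
    have hz : z.1 = s(x, y) := (Sym2.mem_and_mem_iff hxy).1 ⟨hxz, hyz⟩
    obtain ⟨T, hvT, hTA, hTm⟩ := exists_subsuperset_card_eq
      (s := {v}) (t := ({p | (p ∈ x ∧ p ∉ y) ∧ p ∈ S} : Finset P)) (n := m)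
      (by simp [hvx, hvy, hvS]) (by rw [card_singleton]; omega)
      (le_card_reserved_private hS hm hxy)
    refine ⟨T, fun p hp => ?_, hvT (mem_singleton_self v), hTm, fun C₀ => ?_⟩
    · have := hTA hp
      simp only [mem_filter, mem_univ, true_and] at this
      exact mem_supp z hz this.2 this.1.1 this.1.2
    · refine le_trans (Set.ncard_le_ncard ?_ (Set.toFinite _))
        (ncard_lineType_extend_eq_le hd f hTm hTA C₀)
      rintro C ⟨h1, h2⟩
      exact ⟨h1, h2 x y hz⟩
  -- This `β` splits `q` as `β + β / (m - 1)`, and the entropy condition says exactly that `k m! / β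
  -- ^ (m - 1)` fits in the second summand.
  · set β : ℝ := (q : ℝ) * ((m : ℝ) - 1) / m with hβ
    have hβ0 : 0 < β := by positivity
    have h1 : (k : ℝ) * m.factorial / β ^ (m - 1) ≤ β / (m - 1) := by
      rw [div_le_div_iff₀ (by positivity) hm1, ← pow_succ', Nat.sub_add_cancel (by omega)]
      linarith
    have h2 : β + β / (m - 1) = q := by
      rw [hβ]
      field_simp
      ring
    linarith

end Extension

end LegitimateColoring

/-! ### Case analysis on the number of colors and the order -/

theorem mainTheorem2 {P L : Type*} [Membership P L] [Finite P] [Finite L]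
    [Configuration.ProjectivePlane P L] (a b d : ℕ) (S : Set P)
    (hS : LegitimateColoring.IsReserved L S)
    (hf : ∃ f : {p : P // p ∉ S} → Fin d,
      ∀ p : P, (LegitimateColoring.dangerousPairsAt L f p).ncard ≤ a * b) :
    ∃ C : P → Fin (max d ⌈LegitimateColoring.entropyBound (a * b)⌉₊),
      LegitimateColoring.IsLegitimate L C := by
  have := Fintype.ofFinite P
  have := Fintype.ofFinite L
  obtain ⟨f, hf⟩ := hf
  have hd : d ≤ max d ⌈LegitimateColoring.entropyBound (a * b)⌉₊ := le_max_left _ _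
  have hE : LegitimateColoring.entropyBound (a * b) ≤
      (max d ⌈LegitimateColoring.entropyBound (a * b)⌉₊ : ℕ) :=
    (Nat.le_ceil _).trans (by exact_mod_cast le_max_right _ _)
  generalize max d ⌈LegitimateColoring.entropyBound (a * b)⌉₊ = q at hd hE ⊢
  generalize a * b = k at hf hE
  have hEle : ∀ {r : ℕ}, q ≤ r → LegitimateColoring.entropyBound k ≤ (r : ℕ) :=
    fun hr => hE.trans (by exact_mod_cast hr)
  have hn2 := Configuration.ProjectivePlane.one_lt_order P L
  obtain ⟨n, hn⟩ : ∃ n, Configuration.ProjectivePlane.order P L = n := ⟨_, rfl⟩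
  have hbound := LegitimateColoring.order_bound f hf hn
  have hlift : ∀ c, c ≤ q → (∃ C : P → Fin c, LegitimateColoring.IsLegitimate L C) →
      ∃ C : P → Fin q, LegitimateColoring.IsLegitimate L C :=
    fun c hc ⟨C, hC⟩ => ⟨_, hC.comp (Fin.castLE_injective hc)⟩
  rw [hn] at hn2
  rcases le_or_gt 12 q with h12 | h12
  · refine hlift 12 h12 (LegitimateColoring.exists_isLegitimate_of_lt 12 (n / 12) ?_)
    rw [hn]
    exact LegitimateColoring.first_moment_lt_twelve hn2
  rcases le_or_gt 10 q with h10 | h10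
  · refine hlift 10 h10 ?_
    rcases le_or_gt n 6 with h6 | h6
    -- With second argument `0` the multinomial bound is the trivial `n!`, which suffices for tiny
    -- orders.
    · refine LegitimateColoring.exists_isLegitimate_of_lt 10 0 ?_
      rw [hn]
      interval_cases n <;> norm_num [Nat.factorial, Nat.choose_two_right]
    rcases le_or_gt 400 n with h400 | h400
    · refine LegitimateColoring.exists_isLegitimate_of_lt 10 (n / 10) ?_
      rw [hn]
      exact LegitimateColoring.first_moment_lt_ten h400
    exfalso
    have hk := LegitimateColoring.le_of_entropyBound_le_eleven (hEle (by omega : q ≤ 11))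
    have hd' : d ≤ 11 := by omega
    -- At most `11` colors force `k ≤ 281`; the windows below cover `7 ≤ n ≤ 399`.
    have key := fun j a b g han hnb hj =>
      LegitimateColoring.order_bound_contradiction j a b 11 281 g hbound han hnb hd' hk hj
    rcases le_or_gt n 7 with h | h
    · exact key 2 7 7 387 h6 h (by norm_num) (by norm_num) (by norm_num)
    rcases le_or_gt n 15 with h' | h'
    · exact key 2 8 15 299 h h' (by norm_num) (by norm_num) (by norm_num)
    rcases le_or_gt n 127 with h | h
    · exact key 4 16 127 459 h' h (by norm_num) (by norm_num) (by norm_num)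
    · exact key 7 128 399 1000 h (by omega) (by norm_num) (by norm_num) (by norm_num)
  have hk9 := LegitimateColoring.le_of_entropyBound_le_nine (hEle (by omega : q ≤ 9))
  rcases (by omega : n = 2 ∨ n = 3 ∨ 4 ≤ n) with h2 | h3 | h4
  · rcases le_or_gt 8 q with h8 | h8
    · refine hlift 8 h8 (LegitimateColoring.exists_isLegitimate_of_lt 8 0 ?_)
      rw [hn, h2]
      norm_num [Nat.factorial, Nat.choose_two_right]
    · exact (LegitimateColoring.order_bound_contradiction 1 2 2 7 11 102 hbound h2.ge h2.le
        (by omega) (LegitimateColoring.le_of_entropyBound_le_seven (hEle (by omega : q ≤ 7)))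
        (by norm_num) (by norm_num) (by norm_num)).elim
  · rcases le_or_gt 9 q with h9 | h9
    · refine hlift 9 h9 (LegitimateColoring.exists_isLegitimate_of_lt 9 0 ?_)
      rw [hn, h3]
      norm_num [Nat.factorial, Nat.choose_two_right]
    · exact (LegitimateColoring.order_bound_contradiction 1 3 3 8 24 92 hbound h3.ge h3.le
        (by omega) (LegitimateColoring.le_of_entropyBound_le_eight (hEle (by omega : q ≤ 8)))
        (by norm_num) (by norm_num) (by norm_num)).elim
  -- `1097` is the first integer above `e ^ 7`, and `7 = 9 - 2` is the largest index needed when `q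
  -- ≤ 9`.
  rcases lt_or_ge n 1097 with hlt | hge
  · exfalso
    have key := fun j a b g han hnb hj =>
      LegitimateColoring.order_bound_contradiction j a b 9 53 g hbound han hnb
        (by omega) hk9 hj
    rcases le_or_gt n 15 with h | h
    · exact key 2 4 15 329 h4 h (by norm_num) (by norm_num) (by norm_num)
    rcases le_or_gt n 127 with h' | h'
    · exact key 4 16 127 700 h h' (by norm_num) (by norm_num) (by norm_num)
    rcases le_or_gt n 511 with h | h
    · exact key 7 128 511 1000 h' h (by norm_num) (by norm_num) (by norm_num)
    rcases le_or_gt n 1023 with h' | h'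
    · exact key 9 512 1023 189 h h' (by norm_num) (by norm_num) (by norm_num)
    · exact key 10 1024 1096 1000 h' (by omega) (by norm_num) (by norm_num) (by norm_num)
  · obtain ⟨m, hm2, hm7, hm⟩ := LegitimateColoring.exists_entropyTerm_le (M := 7) (by omega)
      (by omega) hE
    have hlog : (7 : ℝ) < Real.log n := by
      rw [Real.lt_log_iff_exp_lt (by positivity)]
      have h1 : Real.exp 7 = Real.exp 1 ^ 7 := by rw [← Real.exp_nat_mul]; norm_num
      have h2 : Real.exp 1 ^ 7 < 2.7182818286 ^ 7 := by
        gcongr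
        exact Real.exp_one_lt_d9
      have h3 : (1097 : ℝ) ≤ n := by exact_mod_cast hge
      rw [h1]
      refine h2.trans (lt_of_lt_of_le ?_ h3)
      norm_num
    -- With no colors, `d = 0` and `k = 0`, and the second moment inequality would bound a positive
    -- number by `0`.
    have hq : 0 < q := by
      rcases Nat.eq_zero_or_pos q with rfl | hq
      · exfalso
        have hd0 : d = 0 := by omega
        have hk0 : k = 0 := by
          have hm1 : (0 : ℝ) < (m : ℝ) - 1 := by
            have : (2 : ℝ) ≤ m := by exact_mod_cast hm2
            linarith
          have hfac : (0 : ℝ) < m.factorial := by exact_mod_cast m.factorial_pos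
          rw [Nat.cast_zero, zero_mul, zero_div, zero_pow (by omega)] at hm
          by_contra hk
          have hkpos : (0 : ℝ) < k := by exact_mod_cast Nat.pos_of_ne_zero hk
          have : 0 < (m.factorial : ℝ) * k * ((m : ℝ) - 1) := by positivity
          linarith
        subst hd0 hk0
        have hn0 : (0 : ℝ) < n := by positivity
        have : (0 : ℝ) < ((2 * n + 1) * (n * (n + 1)) - 2 * (0 : ℕ) : ℝ) *
            (242 * Real.log n ^ 2) := by
          rw [Nat.cast_zero, mul_zero, sub_zero]
          have : 0 < Real.log n := by linarith
          positivity
        rw [Nat.cast_zero (R := ℝ), zero_mul, zero_mul, zero_mul] at hbound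
        simp only [Nat.cast_zero] at this
        linarith
      · exact hq
    refine LegitimateColoring.exists_isLegitimate_of_entropyTerm_le hd f hS hf hm2 ?_ hq hm
    rw [hn]
    have : (m : ℝ) ≤ 7 := by exact_mod_cast hm7
    linarith
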